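/- All graphs are finite and simple. A cograph is a graph with no induced path on four vertices. A cluster is the complement of a complete multipartite graph, i.e. a disjoint union of cliques. For $s,k\in\{0,1,2,\dots\}\cup\{\infty\}$, a graph is $(s,k)$-polar if its vertex set has a partition $(A,B)$ (with $A$ or $B$ possibly empty) such that $A$ induces a complete multipartite graph with at most $s$ parts and $B$ induces a cluster with at most $k$ connected components ($\infty$ means no bound); polar means $(\infty,\infty)$-polar. A cograph minimal $(s,k)$-polar obstruction is a cograph that is not $(s,k)$-polar but all of whose proper induced subgraphs are; a cograph minimal polar obstruction is a cograph minimal $(\infty,\infty)$-polar obstruction. $P_3$ is the path on three vertices, $+$ denotes disjoint union of graphs, and $\overline{F}$ the complement of $F$. Let $k\ge 2$ be an integer and let $G$ be a graph. 1. If $G$ is disconnected, then $G$ is a cograph minimal $(k,\infty)$-polar obstruction if and only if $G$ is a cograph minimal polar obstruction. 2. $G$ is a connected cograph minimal $(\infty,k)$-polar obstruction if and only if $G$ is a connected cograph minimal polar obstruction. 3. $G$ is a connected cograph minimal $(\infty,k)$-polar obstruction if and only if $G\cong\overline{P_3+H}$ for some cograph minimal $(1,\infty)$-polar obstruction $H$.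 4. There is a finite list of graphs, independent of $k$, such that for every integer $k\ge 2$ the connected cograph minimal $(\infty,k)$-polar obstructions are, up to isomorphism, exactly the graphs in the list. -/

import Mathlib

universe u

/-- A graph is a cograph if it contains no induced path on four vertices. -/
def IsCograph {V : Type*} (G : SimpleGraph V) : Prop :=
  ¬ (SimpleGraph.pathGraph 4).IsIndContained G

/-- `G` is a complete multipartite graph with at most `s` (non-empty) parts; `s = ⊤` puts no
bound on the number of parts. The parts are the classes of the relation "equal or non-adjacent". -/
def IsCompleteMultipartiteLE {V : Type*} (G : SimpleGraph V) (s : ℕ∞) : Prop :=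
  ∃ h : G.IsCompleteMultipartite, ENat.card (Quotient h.setoid) ≤ s

/-- A cluster is the complement of a complete multipartite graph. -/
def IsCluster {V : Type*} (G : SimpleGraph V) : Prop :=
  Gᶜ.IsCompleteMultipartite

/-- `G` is a `k`-cluster: a cluster with at most `k` connected components; `k = ⊤` puts no
bound on the number of components. -/
def IsClusterLE {V : Type*} (G : SimpleGraph V) (k : ℕ∞) : Prop :=
  IsCluster G ∧ ENat.card G.ConnectedComponent ≤ k

/-- `G` is `(s, k)`-polar: its vertex set is partitioned into `A` and `B` (possibly empty), where
`A` induces a complete multipartite graph with at most `s` parts and `B` induces a `k`-cluster. -/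
def IsPolar {V : Type*} (s k : ℕ∞) (G : SimpleGraph V) : Prop :=
  ∃ A B : Set V, IsCompl A B ∧
    IsCompleteMultipartiteLE (G.induce A) s ∧ IsClusterLE (G.induce B) k

/-- `G` is a cograph minimal `(s, k)`-polar obstruction: a cograph that is not `(s, k)`-polar,
all of whose proper induced subgraphs are `(s, k)`-polar. -/
def IsCographMinimalObstruction {V : Type*} (s k : ℕ∞) (G : SimpleGraph V) : Prop :=
  IsCograph G ∧ ¬ IsPolar s k G ∧ ∀ S : Set V, S ≠ Set.univ → IsPolar s k (G.induce S)

/-- Cograph minimal polar obstructions: polar means `(∞, ∞)`-polar. -/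
def IsCographMinimalPolarObstruction {V : Type*} (G : SimpleGraph V) : Prop :=
  IsCographMinimalObstruction ⊤ ⊤ G

/-! The key fact is that for every `k ≥ 2`, including `k = ⊤`, the disconnected cograph minimal `(k,
∞)`-polar obstructions are the graphs `P₃ + F` with `F` a minimal `(1, ∞)`-polar obstruction. This
description does not mention `k`, so it gives claim 1; complementing gives claims 2 and 3.

If `P₃ + F` were polar, either the multipartite side would meet `P₃`, hence be independent on `F`,
or `P₃` would lie in the cluster; both are impossible (`not_isPolar_pathGraph_three_sum`).
Conversely, `(1, ∞)`-polarity survives disjoint unions, so a disconnected minimal obstruction has a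
side that is not `(1, ∞)`-polar. The other side cannot be a cluster, so it contains `P₃`, and
minimality forces `P₃ + F`. That `P₃ + F` is itself minimal rests on `polarOn_two`: every minimal
`(1, ∞)`-polar obstruction is `(2, ∞)`-polar, as one sees by writing it as a join.

Claim 4 then needs only finitely many such `F`. Cographs are well-quasi-ordered by induced subgraphs
(a minimal bad sequence argument on unions and joins), and non-isomorphic minimal obstructions are
incomparable. -/

open SimpleGraph

variable {V W : Type*} {G : SimpleGraph V} {H : SimpleGraph W} {s k : ℕ∞}

/-! ### Complete multipartite graphs and clusters -/

theorem IsCompleteMultipartiteLE.of_embedding (f : H ↪g G) (hG : IsCompleteMultipartiteLE G s) :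
    IsCompleteMultipartiteLE H s := by
  obtain ⟨h, hs⟩ := hG
  refine ⟨h.comap f, le_trans ?_ hs⟩
  refine ENat.card_le_card_of_injective
    (f := Quotient.map' (s₁ := (h.comap f).setoid) (s₂ := h.setoid) f
      fun a b hab => by
        change ¬ G.Adj _ _
        rw [f.map_adj_iff]
        exact hab) ?_
  intro a b
  induction a using Quotient.inductionOn'
  induction b using Quotient.inductionOn'
  intro hab
  rw [Quotient.map'_mk'', Quotient.map'_mk'', Quotient.eq''] at hab
  rw [Quotient.eq'']
  change ¬ G.Adj _ _ at hab
  rw [f.map_adj_iff] at hab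
  exact hab

theorem IsCompleteMultipartiteLE.of_coloring {α : Type*} (c : V → α)
    (hc : ∀ x y, G.Adj x y ↔ c x ≠ c y) (hα : ENat.card α ≤ s) : IsCompleteMultipartiteLE G s := by
  have h : G.IsCompleteMultipartite := ⟨fun x y z hxy hyz => by
    rw [hc, not_not] at *
    exact hxy.trans hyz⟩
  refine ⟨h, le_trans ?_ hα⟩
  refine ENat.card_le_card_of_injective
    (f := Quotient.lift (s := h.setoid) c fun a b hab => by
        have : ¬ G.Adj a b := hab
        rwa [hc, not_not] at this) ?_
  intro a b
  induction a using Quotient.inductionOn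
  induction b using Quotient.inductionOn
  intro hab
  apply Quotient.sound
  change ¬ G.Adj _ _
  rw [hc, not_not]
  exact hab

theorem IsCompleteMultipartiteLE.mono (hsk : s ≤ k) (h : IsCompleteMultipartiteLE G s) :
    IsCompleteMultipartiteLE G k :=
  ⟨h.1, h.2.trans hsk⟩

theorem isCompleteMultipartiteLE_one_iff :
    IsCompleteMultipartiteLE G 1 ↔ ∀ x y, ¬ G.Adj x y := by
  constructor
  · rintro ⟨h, hs⟩ x y
    have := (ENat.card_le_one_iff_subsingleton _).1 hs
    have hxy := Subsingleton.elim (Quotient.mk h.setoid x) (Quotient.mk h.setoid y)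
    exact Quotient.exact hxy
  · intro h
    exact .of_coloring (fun _ => ()) (by simpa using h) (by simp)

/-- In a cluster, reachable vertices are equal or adjacent, so the components are the parts of the
complement. -/
theorem isClusterLE_iff_compl : IsClusterLE G k ↔ IsCompleteMultipartiteLE Gᶜ k := by
  have key : ∀ h : Gᶜ.IsCompleteMultipartite,
      ENat.card (Quotient h.setoid) = ENat.card G.ConnectedComponent := by
    intro h
    refine ENat.card_congr (Quot.congrRight fun x y => ?_)
    change ¬ Gᶜ.Adj x y ↔ G.Reachable x y
    constructor
    · intro hxy
      by_cases hne : x = y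
      · exact hne ▸ Reachable.refl _
      · rw [compl_adj] at hxy
        push Not at hxy
        exact (hxy hne).reachable
    · rintro ⟨p⟩
      induction p with
      | nil => simp
      | cons hadj _ ih => exact h.trans _ _ _ (fun h' => h'.2 hadj) ih
  exact ⟨fun ⟨h, hk⟩ => ⟨h, (key h).trans_le hk⟩, fun ⟨h, hk⟩ => ⟨h, (key h).symm.trans_le hk⟩⟩

theorem isPolar_iff : IsPolar s k G ↔ ∃ A : Set V,
    IsCompleteMultipartiteLE (G.induce A) s ∧ IsCompleteMultipartiteLE (Gᶜ.induce Aᶜ) k := by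
  have key : ∀ B : Set V, (G.induce B)ᶜ = Gᶜ.induce B := fun B => by
    ext
    simp [Subtype.ext_iff]
  simp only [IsPolar, isClusterLE_iff_compl, key]
  constructor
  · rintro ⟨A, B, h, hA, hB⟩
    rw [← h.compl_eq] at hB
    exact ⟨A, hA, hB⟩
  · rintro ⟨A, hA, hB⟩
    exact ⟨A, Aᶜ, isCompl_compl, hA, hB⟩

theorem isPolar_compl : IsPolar s k Gᶜ ↔ IsPolar k s G := by
  simp only [isPolar_iff, compl_compl]
  constructor
  · rintro ⟨A, hA, hB⟩
    exact ⟨Aᶜ, hB, by rwa [compl_compl]⟩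
  · rintro ⟨A, hA, hB⟩
    exact ⟨Aᶜ, hB, by rwa [compl_compl]⟩

/-- The embedding of induced subgraphs given by an embedding of graphs. -/
def SimpleGraph.Embedding.inducePreimage (f : H ↪g G) (A : Set V) :
    H.induce (f ⁻¹' A) ↪g G.induce A where
  toFun x := ⟨f x, x.2⟩
  inj' _ _ hxy := Subtype.ext (f.injective (congrArg Subtype.val hxy))
  map_rel_iff' := f.map_adj_iff

theorem IsPolar.of_embedding (f : H ↪g G) (h : IsPolar s k G) : IsPolar s k H := by
  rw [isPolar_iff] at *
  obtain ⟨A, hA, hB⟩ := h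
  exact ⟨f ⁻¹' A, hA.of_embedding (f.inducePreimage A),
    hB.of_embedding ((Embedding.complEquiv f).inducePreimage Aᶜ)⟩

/-! ### Polarity of vertex subsets -/

/-- No edge between two vertices of `A`. -/
def IndepOn (G : SimpleGraph V) (A : Set V) : Prop := ∀ x ∈ A, ∀ y ∈ A, ¬ G.Adj x y

/-- No edge between `A` and `B`. -/
def NoEdges (G : SimpleGraph V) (A B : Set V) : Prop := ∀ x ∈ A, ∀ y ∈ B, ¬ G.Adj x y

/-- Every vertex of `A` is adjacent to every vertex of `B`. -/
def AllEdges (G : SimpleGraph V) (A B : Set V) : Prop := ∀ x ∈ A, ∀ y ∈ B, G.Adj x y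

/-- `B` induces no path on three vertices. -/
def ClusterOn (G : SimpleGraph V) (B : Set V) : Prop :=
  ∀ x ∈ B, ∀ y ∈ B, ∀ z ∈ B, G.Adj x y → G.Adj y z → x ≠ z → G.Adj x z

/-- `X` is the union of an independent set and a clique. -/
def SplitOn (G : SimpleGraph V) (X : Set V) : Prop :=
  ∃ A B, A ∪ B = X ∧ IndepOn G A ∧ G.IsClique B

/-- The subgraph induced by `X` is `(s, ∞)`-polar. -/
def PolarOn (G : SimpleGraph V) (s : ℕ∞) (X : Set V) : Prop :=
  ∃ A B, A ∪ B = X ∧ IsCompleteMultipartiteLE (G.induce A) s ∧ ClusterOn G B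

theorem IndepOn.mono {A B : Set V} (h : IndepOn G B) (hAB : A ⊆ B) : IndepOn G A :=
  fun x hx y hy => h x (hAB hx) y (hAB hy)

theorem ClusterOn.mono {A B : Set V} (h : ClusterOn G B) (hAB : A ⊆ B) : ClusterOn G A :=
  fun x hx y hy z hz => h x (hAB hx) y (hAB hy) z (hAB hz)

theorem NoEdges.symm {A B : Set V} (h : NoEdges G A B) : NoEdges G B A :=
  fun x hx y hy hxy => h y hy x hx hxy.symm

theorem AllEdges.symm {A B : Set V} (h : AllEdges G A B) : AllEdges G B A :=
  fun x hx y hy => (h y hy x hx).symm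

theorem SimpleGraph.IsClique.clusterOn {A : Set V} (h : G.IsClique A) : ClusterOn G A :=
  fun _ hx _ _ _ hz _ _ hne => h hx hz hne

theorem IndepOn.clusterOn {A : Set V} (h : IndepOn G A) : ClusterOn G A :=
  fun x hx y hy _ _ hxy => (h x hx y hy hxy).elim

theorem IndepOn.splitOn {A : Set V} (h : IndepOn G A) : SplitOn G A :=
  ⟨A, ∅, by simp, h, by simp⟩

theorem ClusterOn.union {A B : Set V} (hA : ClusterOn G A) (hB : ClusterOn G B)
    (h : NoEdges G A B) : ClusterOn G (A ∪ B) := by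
  rintro x (hx | hx) y (hy | hy) z (hz | hz) hxy hyz hne
  · exact hA x hx y hy z hz hxy hyz hne
  · exact (h y hy z hz hyz).elim
  · exact (h x hx y hy hxy).elim
  · exact (h x hx y hy hxy).elim
  · exact (h y hy x hx hxy.symm).elim
  · exact (h y hy x hx hxy.symm).elim
  · exact (h z hz y hy hyz.symm).elim
  · exact hB x hx y hy z hz hxy hyz hne

theorem IndepOn.union {A B : Set V} (hA : IndepOn G A) (hB : IndepOn G B)
    (h : NoEdges G A B) : IndepOn G (A ∪ B) := by
  rintro x (hx | hx) y (hy | hy)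
  exacts [hA x hx y hy, h x hx y hy, h.symm x hx y hy, hB x hx y hy]

theorem indepOn_iff {A : Set V} :
    IsCompleteMultipartiteLE (G.induce A) 1 ↔ IndepOn G A := by
  simp [isCompleteMultipartiteLE_one_iff, IndepOn]

theorem isCompleteMultipartiteLE_two_of_allEdges {A B : Set V} (hA : IndepOn G A)
    (hB : IndepOn G B) (h : AllEdges G A B) :
    IsCompleteMultipartiteLE (G.induce (A ∪ B)) 2 := by
  have hd : ∀ x ∈ A, x ∉ B := fun x hx hx' => G.irrefl (h x hx x hx')
  refine .of_coloring (α := Prop) (fun x => x.1 ∈ A) ?_ (by simp [ENat.card_eq_coe_fintype_card])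
  rintro ⟨x, hx⟩ ⟨y, hy⟩
  rw [comap_adj, Function.Embedding.subtype_apply, Function.Embedding.subtype_apply, Ne,
    eq_iff_iff]
  rcases hx with hx | hx <;> rcases hy with hy | hy
  · simp [hx, hy, hA x hx y hy]
  · have : y ∉ A := fun h' => hd y h' hy
    simp [hx, this, h x hx y hy]
  · have : x ∉ A := fun h' => hd x h' hx
    simp [hy, this, h.symm x hx y hy]
  · have h1 : x ∉ A := fun h' => hd x h' hx
    have h2 : y ∉ A := fun h' => hd y h' hy
    simp [h1, h2, hB x hx y hy]

theorem IsCompleteMultipartiteLE.subset {A B : Set V} (hAB : A ⊆ B)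
    (h : IsCompleteMultipartiteLE (G.induce B) s) : IsCompleteMultipartiteLE (G.induce A) s :=
  h.of_embedding (induceHomOfLE G hAB)

theorem clusterOn_iff {B : Set V} :
    IsCompleteMultipartiteLE (Gᶜ.induce B) ⊤ ↔ ClusterOn G B := by
  constructor
  · rintro ⟨h, -⟩ x hx y hy z hz hxy hyz hne
    by_contra hxz
    exact h.trans ⟨x, hx⟩ ⟨y, hy⟩ ⟨z, hz⟩ (by simp [hxy]) (by simp [hyz]) (by simp [hne, hxz])
  · intro h
    refine ⟨⟨?_⟩, le_top⟩
    rintro ⟨x, hx⟩ ⟨y, hy⟩ ⟨z, hz⟩ hxy hyz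
    simp only [comap_adj, Function.Embedding.subtype_apply, compl_adj, not_and, not_not] at *
    intro hne
    by_cases h1 : x = y
    · exact h1 ▸ hyz (h1 ▸ hne)
    by_cases h2 : y = z
    · exact h2 ▸ hxy h1
    exact h x hx y hy z hz (hxy h1) (hyz h2) hne

/-- The two sides in `PolarOn` may overlap; this is harmless because clusters are hereditary. -/
theorem isPolar_iff_polarOn_univ : IsPolar s ⊤ G ↔ PolarOn G s Set.univ := by
  rw [isPolar_iff]
  constructor
  · rintro ⟨A, hA, hB⟩
    exact ⟨A, Aᶜ, by simp, hA, clusterOn_iff.1 hB⟩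
  · rintro ⟨A, B, h, hA, hB⟩
    refine ⟨A, hA, clusterOn_iff.2 (hB.mono fun x hx => ?_)⟩
    have : x ∈ A ∪ B := h ▸ Set.mem_univ x
    exact this.resolve_left hx

theorem PolarOn.mono {X Y : Set V} (h : PolarOn G s Y) (hXY : X ⊆ Y) : PolarOn G s X := by
  obtain ⟨A, B, rfl, hA, hB⟩ := h
  refine ⟨A ∩ X, B ∩ X, ?_, hA.subset Set.inter_subset_left, hB.mono Set.inter_subset_left⟩
  rw [← Set.union_inter_distrib_right, Set.inter_eq_right.2 hXY]

theorem polarOn_image_iff (f : H ↪g G) {X : Set W} : PolarOn G s (f '' X) ↔ PolarOn H s X := by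
  constructor
  · rintro ⟨A, B, h, hA, hB⟩
    refine ⟨f ⁻¹' A, f ⁻¹' B, ?_, hA.of_embedding (f.inducePreimage A), ?_⟩
    · rw [← Set.preimage_union, h, Set.preimage_image_eq _ f.injective]
    · intro x hx y hy z hz hxy hyz hne
      exact f.map_adj_iff.1 (hB _ hx _ hy _ hz (f.map_adj_iff.2 hxy) (f.map_adj_iff.2 hyz)
        (f.injective.ne hne))
  · rintro ⟨A, B, rfl, hA, hB⟩
    refine ⟨f '' A, f '' B, (Set.image_union ..).symm, ?_, ?_⟩
    · refine hA.of_embedding (H := G.induce (f '' A))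
        ⟨⟨fun x => ⟨x.2.choose, x.2.choose_spec.1⟩, fun x y hxy => ?_⟩, fun {x y} => ?_⟩
      · have := congrArg f (congrArg Subtype.val hxy)
        simp only [x.2.choose_spec.2, y.2.choose_spec.2] at this
        exact Subtype.ext this
      · change H.Adj x.2.choose y.2.choose ↔ G.Adj x.1 y.1
        rw [← f.map_adj_iff, x.2.choose_spec.2, y.2.choose_spec.2]
    · rintro _ ⟨x, hx, rfl⟩ _ ⟨y, hy, rfl⟩ _ ⟨z, hz, rfl⟩ hxy hyz hne
      exact f.map_adj_iff.2 (hB _ hx _ hy _ hz (f.map_adj_iff.1 hxy) (f.map_adj_iff.1 hyz)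
        fun h => hne (congrArg f h))

theorem isPolar_induce_iff {X : Set V} : IsPolar s ⊤ (G.induce X) ↔ PolarOn G s X := by
  rw [isPolar_iff_polarOn_univ, ← polarOn_image_iff (Embedding.induce X)]
  congr!
  rw [Set.image_univ]
  exact Subtype.range_coe

theorem PolarOn.union_clusterOn {X Y : Set V} (hX : PolarOn G s X) (hY : ClusterOn G Y)
    (h : NoEdges G X Y) : PolarOn G s (X ∪ Y) := by
  obtain ⟨A, B, rfl, hA, hB⟩ := hX
  exact ⟨A, B ∪ Y, by rw [Set.union_assoc], hA, hB.union hY fun x hx => h x (Or.inr hx)⟩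

theorem polarOn_one_iff {X : Set V} :
    PolarOn G 1 X ↔ ∃ A B, A ∪ B = X ∧ IndepOn G A ∧ ClusterOn G B := by
  simp only [PolarOn, indepOn_iff]

/-- Special to `s = 1`: independent sets with no edges between them have independent union, but
multipartite graphs with two parts do not combine this way. -/
theorem PolarOn.union_of_noEdges {X Y : Set V} (hX : PolarOn G 1 X) (hY : PolarOn G 1 Y)
    (h : NoEdges G X Y) : PolarOn G 1 (X ∪ Y) := by
  rw [polarOn_one_iff] at *
  obtain ⟨A, B, rfl, hA, hB⟩ := hX
  obtain ⟨C, D, rfl, hC, hD⟩ := hY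
  exact ⟨A ∪ C, B ∪ D, Set.union_union_union_comm ..,
    hA.union hC fun x hx y hy => h x (.inl hx) y (.inl hy),
    hB.union hD fun x hx y hy => h x (.inr hx) y (.inr hy)⟩

theorem PolarOn.le {X : Set V} (hsk : s ≤ k) (h : PolarOn G s X) : PolarOn G k X := by
  obtain ⟨A, B, h, hA, hB⟩ := h
  exact ⟨A, B, h, hA.mono hsk, hB⟩

/-! ### Cographs -/

theorem IsCograph.of_embedding (f : H ↪g G) (h : IsCograph G) : IsCograph H :=
  fun ⟨g⟩ => h ⟨f.comp g⟩

theorem isCograph_iff : IsCograph G ↔ ∀ a b c d, G.Adj a b → G.Adj b c → G.Adj c d →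
    ¬ G.Adj a c → ¬ G.Adj b d → G.Adj a d := by
  constructor
  · intro h a b c d hab hbc hcd hac hbd
    by_contra had
    have adj : ∀ i j : Fin 4, G.Adj (![a, b, c, d] i) (![a, b, c, d] j) ↔ (pathGraph 4).Adj i j := by
      intro i j
      rw [pathGraph_adj]
      fin_cases i <;> fin_cases j <;>
        simp [hab, hbc, hcd, hac, hbd, had, hab.symm, hbc.symm, hcd.symm, mt Adj.symm hac,
          mt Adj.symm hbd, mt Adj.symm had]
    refine h ⟨⟨⟨![a, b, c, d], fun i j hij => ?_⟩, adj _ _⟩⟩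
    -- Injectivity is automatic: distinct vertices of the path have distinct neighbourhoods.
    have hi : ∀ l, (pathGraph 4).Adj i l ↔ (pathGraph 4).Adj j l := fun l => by
      rw [← adj, ← adj, hij]
    simp only [pathGraph_adj] at hi
    have h0 := hi 0
    have h1 := hi 1
    have h2 := hi 2
    have h3 := hi 3
    fin_cases i <;> fin_cases j <;> simp at h0 h1 h2 h3 ⊢
  · rintro h ⟨f⟩
    have := h (f 0) (f 1) (f 2) (f 3)
    simp [f.map_adj_iff, pathGraph_adj] at this

theorem isCograph_compl : IsCograph Gᶜ ↔ IsCograph G := by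
  have key : ∀ {G : SimpleGraph V}, IsCograph G → IsCograph Gᶜ := by
    intro G h
    rw [isCograph_iff] at *
    intro a b c d hab hbc hcd hac hbd
    by_cases hac' : a = c
    · subst hac'
      exact hcd
    by_cases hbd' : b = d
    · subst hbd'
      exact hab
    simp only [compl_adj] at *
    have h1 : G.Adj a c := by tauto
    have h2 : G.Adj b d := by tauto
    have hne : a ≠ d := by
      rintro rfl
      exact hab.2 h2.symm
    refine ⟨hne, fun had => hbc.2 ?_⟩
    -- The complement of the path `a b c d` is the path `c a d b`.
    have := h c a d b h1.symm had h2.symm (fun h' => hcd.2 h') (fun h' => hab.2 h')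
    exact this.symm
  exact ⟨fun h => by simpa using key h, key⟩

/-- `X` splits into two non-empty parts with no edge between them. -/
def DisjointSplit (G : SimpleGraph V) (X : Set V) : Prop :=
  ∃ S T, S.Nonempty ∧ T.Nonempty ∧ Disjoint S T ∧ S ∪ T = X ∧ NoEdges G S T

theorem noEdges_compl_iff {A B : Set V} (hd : Disjoint A B) :
    NoEdges Gᶜ A B ↔ AllEdges G A B := by
  constructor
  · intro h x hx y hy
    by_contra hxy
    exact h x hx y hy ⟨fun h' => hd.ne_of_mem hx hy h', hxy⟩
  · exact fun h x hx y hy hxy => hxy.2 (h x hx y hy)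

theorem IsCograph.disjointSplit_insert (hG : IsCograph G) {X : Set V} {v : V} (hv : v ∉ X)
    (hX : DisjointSplit G X) :
    DisjointSplit G (insert v X) ∨ DisjointSplit Gᶜ (insert v X) := by
  obtain ⟨S, T, hS, hT, hd, rfl, hST⟩ := hX
  rw [isCograph_iff] at hG
  by_cases hall : ∀ u ∈ S ∪ T, G.Adj v u
  · right
    refine ⟨{v}, S ∪ T, by simp, hS.mono Set.subset_union_left, by simpa using hv, by simp, ?_⟩
    rintro _ rfl u hu hvu
    exact hvu.2 (hall u hu)
  left
  push Not at hall
  obtain ⟨u, hu, hvu⟩ := hall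
  wlog huS : u ∈ S generalizing S T
  · have := this T S hT hS hd.symm hST.symm (by rwa [Set.union_comm]) (by rwa [Set.union_comm])
      (hu.resolve_left huS)
    rwa [Set.union_comm]
  by_cases hvT : ∃ z ∈ T, G.Adj v z
  · obtain ⟨z, hz, hvz⟩ := hvT
    -- The non-neighbours of `v` in `S` split off: an edge from such a `y` to a neighbour `x ∈ S` of
    -- `v` would give the induced path `y x v z`.
    refine ⟨{y ∈ S | ¬ G.Adj v y}, insert v (T ∪ {x ∈ S | G.Adj v x}), ⟨u, huS, hvu⟩, by simp, ?_,
      ?_, ?_⟩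
    · rw [Set.disjoint_left]
      rintro y ⟨hy, hvy⟩ (rfl | hyT | ⟨-, h⟩)
      exacts [hv (.inl hy), Set.disjoint_left.1 hd hy hyT, hvy h]
    · ext y
      simp only [Set.mem_union, Set.mem_insert_iff, Set.mem_ofPred_eq]
      tauto
    · rintro y ⟨hy, hvy⟩ x (rfl | hxT | ⟨hx, hvx⟩) hyx
      · exact hvy hyx.symm
      · exact hST y hy x hxT hyx
      · exact hST y hy z hz (hG y x v z hyx hvx.symm hvz (fun h => hvy h.symm) (hST x hx z hz))
  · push Not at hvT
    refine ⟨T, insert v S, hT, by simp, ?_, by rw [Set.union_insert, Set.union_comm], ?_⟩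
    · rw [Set.disjoint_insert_right]
      exact ⟨fun h => hv (.inr h), hd.symm⟩
    · rintro x hx y (rfl | hy) hxy
      exacts [hvT x hx hxy.symm, hST y hy x hx hxy.symm]

/-- Cographs decompose under union and join, by adding one vertex at a time. -/
theorem IsCograph.disjointSplit (hG : IsCograph G) {X : Set V} (hfin : X.Finite)
    (hX : X.Nontrivial) : DisjointSplit G X ∨ DisjointSplit Gᶜ X := by
  induction X, hfin using Set.Finite.induction_on with
  | empty => simp at hX
  | @insert v X hv _ ih =>
    by_cases hX' : X.Nontrivial
    · rcases ih hX' with h | h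
      · exact hG.disjointSplit_insert hv h
      · have := (isCograph_compl.2 hG).disjointSplit_insert hv h
        rwa [compl_compl, or_comm] at this
    · have hXs := Set.not_nontrivial_iff.1 hX'
      have hne : X.Nonempty := by
        rw [Set.nonempty_iff_ne_empty]
        rintro rfl
        simp at hX
      obtain ⟨u, rfl⟩ := (Set.exists_eq_singleton_iff_nonempty_subsingleton.2 ⟨hne, hXs⟩)
      by_cases hvu : G.Adj v u
      · exact .inr ⟨{v}, {u}, by simp, by simp, by simpa using hv, rfl, by simp [NoEdges, hvu]⟩
      · exact .inl ⟨{v}, {u}, by simp, by simp, by simpa using hv, rfl, by simp [NoEdges, hvu]⟩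

/-! ### Minimal obstructions -/

theorem isCographMinimalObstruction_top_iff : IsCographMinimalObstruction s ⊤ G ↔
    IsCograph G ∧ ¬ PolarOn G s Set.univ ∧ ∀ S : Set V, S ≠ Set.univ → PolarOn G s S := by
  simp only [IsCographMinimalObstruction, isPolar_induce_iff]
  rw [isPolar_iff_polarOn_univ]

theorem IsCographMinimalObstruction.surjective (h : IsCographMinimalObstruction s k G)
    (f : H ↪g G) (hH : ¬ IsPolar s k H) : Function.Surjective f := by
  by_contra hf
  rw [← Set.range_eq_univ] at hf
  exact hH ((h.2.2 _ hf).of_embedding (H := H)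
    ⟨⟨fun x => ⟨f x, x, rfl⟩, fun x y hxy => f.injective (congrArg Subtype.val hxy)⟩,
      f.map_adj_iff⟩)

/-- An embedding of a non-polar graph into a minimal obstruction is an isomorphism. -/
noncomputable def IsCographMinimalObstruction.iso (h : IsCographMinimalObstruction s k G)
    (f : H ↪g G) (hH : ¬ IsPolar s k H) : H ≃g G :=
  RelIso.ofSurjective f (h.surjective f hH)

theorem IsCographMinimalObstruction.of_iso (h : IsCographMinimalObstruction s k G)
    (e : H ≃g G) : IsCographMinimalObstruction s k H := by
  refine ⟨h.1.of_embedding e.toEmbedding, fun hH => h.2.1 (hH.of_embedding e.symm.toEmbedding),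
    fun S hS => ?_⟩
  have := h.2.2 (e.symm ⁻¹' S) fun h' => hS <| by
    rwa [Set.preimage_eq_univ_iff, e.symm.surjective.range_eq, Set.univ_subset_iff] at h'
  have hp : e ⁻¹' (e.symm ⁻¹' S) = S := by
    ext x
    simp
  rw [← hp]
  exact this.of_embedding (e.toEmbedding.inducePreimage _)

theorem isCographMinimalObstruction_compl :
    IsCographMinimalObstruction s k Gᶜ ↔ IsCographMinimalObstruction k s G := by
  have key : ∀ S : Set V, Gᶜ.induce S = (G.induce S)ᶜ := fun S => by
    ext
    simp [Subtype.ext_iff]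
  simp only [IsCographMinimalObstruction, isCograph_compl, key, isPolar_compl]

theorem exists_minimal_obstruction [Finite V] (hG : IsCograph G) {X : Set V}
    (hX : ¬ PolarOn G s X) : ∃ S ⊆ X, IsCographMinimalObstruction s ⊤ (G.induce S) := by
  obtain ⟨S, hSX, hS⟩ := (Set.toFinite {S : Set V | ¬ PolarOn G s S}).exists_le_minimal hX
  refine ⟨S, hSX, hG.of_embedding (Embedding.induce S), ?_, ?_⟩
  · rw [isPolar_induce_iff]
    exact hS.prop
  · intro T hT
    rw [isPolar_induce_iff, ← polarOn_image_iff (Embedding.induce S)]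
    by_contra hT'
    have hsub : Embedding.induce (G := G) S '' T ⊆ S := by
      rintro _ ⟨x, -, rfl⟩
      exact x.2
    apply hT
    rw [Set.eq_univ_iff_forall]
    intro x
    obtain ⟨y, hy, hyx⟩ := hS.le_of_le hT' hsub x.2
    rwa [← Subtype.ext hyx]

theorem polarOn_of_subsingleton {X : Set V} (hX : X.Subsingleton) : PolarOn G s X :=
  PolarOn.mono (Y := X) ⟨∅, X, by simp,
    ⟨⟨fun x => (Set.notMem_empty _ x.2).elim⟩, by
      have : IsEmpty (∅ : Set V) := inferInstance
      rw [ENat.card_eq_zero_iff_empty _ |>.2]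
      · exact zero_le
      · exact ⟨fun q => Quotient.inductionOn' q fun x => this.elim x⟩⟩,
    fun x hx y hy _ _ hxy => (hxy.ne (hX hx hy)).elim⟩ subset_rfl

theorem nontrivial_of_not_isPolar (h : ¬ IsPolar s ⊤ G) : Nontrivial V := by
  by_contra hV
  rw [not_nontrivial_iff_subsingleton] at hV
  exact h (isPolar_iff_polarOn_univ.2 (polarOn_of_subsingleton Set.subsingleton_univ))

theorem DisjointSplit.not_connected (h : DisjointSplit G Set.univ) : ¬ G.Connected := by
  rintro hc
  obtain ⟨S, T, ⟨a, ha⟩, ⟨b, hb⟩, hd, huniv, hST⟩ := h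
  have key : ∀ x y, G.Reachable x y → x ∈ S → y ∈ S := by
    rintro x y ⟨p⟩
    induction p with
    | nil => exact id
    | @cons u v w hadj _ ih =>
      intro hu
      refine ih ?_
      have : v ∈ S ∪ T := huniv ▸ Set.mem_univ v
      exact this.resolve_right fun hv => hST u hu v hv hadj
  exact Set.disjoint_left.1 hd (key a b (hc.preconnected a b) ha) hb

theorem disjointSplit_of_not_connected [Nonempty V] (h : ¬ G.Connected) :
    DisjointSplit G Set.univ := by
  have : ¬ G.Preconnected := fun h' => h ⟨h'⟩
  simp only [Preconnected, not_forall] at this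
  obtain ⟨a, b, hab⟩ := this
  refine ⟨{v | G.Reachable a v}, {v | G.Reachable a v}ᶜ, ⟨a, Reachable.refl _⟩, ⟨b, hab⟩,
    disjoint_compl_right, by simp, ?_⟩
  exact fun x hx y hy hxy => hy (hx.trans hxy.reachable)

/-! ### Minimal monopolar obstructions are `(2, ∞)`-polar -/

theorem ClusterOn.isClique_of_allEdges {X Y : Set V} (h : ClusterOn G (X ∪ Y))
    (hXY : AllEdges G X Y) (hY : Y.Nonempty) : G.IsClique X := by
  obtain ⟨y, hy⟩ := hY
  exact fun x hx z hz hne => h x (.inl hx) y (.inr hy) z (.inl hz) (hXY x hx y hy)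
    (hXY z hz y hy).symm hne

theorem isClique_union_of_allEdges {X Y : Set V} (hXY : AllEdges G X Y)
    (hX : G.IsClique X) (hY : G.IsClique Y) : G.IsClique (X ∪ Y) := by
  rintro x (hx | hx) y (hy | hy) hne
  exacts [hX hx hy hne, hXY x hx y hy, hXY.symm x hx y hy, hY hx hy hne]

/-- An independent set cannot meet both sides of a join, and a cluster meeting both sides is a
clique. -/
theorem PolarOn.join_cases {X Y : Set V} (h : PolarOn G 1 (X ∪ Y)) (hXY : AllEdges G X Y)
    (hX : X.Nonempty) (hY : Y.Nonempty) :
    (IndepOn G X ∧ ClusterOn G Y) ∨ (ClusterOn G X ∧ IndepOn G Y) ∨ SplitOn G X ∧ SplitOn G Y := by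
  obtain ⟨A, B, hAB, hA, hB⟩ := polarOn_one_iff.1 h
  have hXAB : X ⊆ A ∪ B := hAB ▸ Set.subset_union_left
  have hYAB : Y ⊆ A ∪ B := hAB ▸ Set.subset_union_right
  by_cases hX' : X ⊆ A
  · refine .inl ⟨hA.mono hX', hB.mono fun y hy => (hYAB hy).resolve_left fun hyA => ?_⟩
    obtain ⟨x, hx⟩ := hX
    exact hA x (hX' hx) y hyA (hXY x hx y hy)
  by_cases hY' : Y ⊆ A
  · refine .inr (.inl ⟨hB.mono fun x hx => (hXAB hx).resolve_left fun hxA => ?_, hA.mono hY'⟩)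
    obtain ⟨y, hy⟩ := hY
    exact hA x hxA y (hY' hy) (hXY x hx y hy)
  refine .inr (.inr ?_)
  obtain ⟨x, hx, hxA⟩ := Set.not_subset.1 hX'
  obtain ⟨y, hy, hyA⟩ := Set.not_subset.1 hY'
  have hcl : ClusterOn G ((X ∩ B) ∪ (Y ∩ B)) :=
    hB.mono (Set.union_subset Set.inter_subset_right Set.inter_subset_right)
  have hall : AllEdges G (X ∩ B) (Y ∩ B) := fun x hx y hy => hXY x hx.1 y hy.1
  refine ⟨⟨X ∩ A, X ∩ B, ?_, hA.mono Set.inter_subset_right,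
    hcl.isClique_of_allEdges hall ⟨y, hy, (hYAB hy).resolve_left hyA⟩⟩,
    ⟨Y ∩ A, Y ∩ B, ?_, hA.mono Set.inter_subset_right,
    (Set.union_comm _ _ ▸ hcl).isClique_of_allEdges hall.symm
      ⟨x, hx, (hXAB hx).resolve_left hxA⟩⟩⟩
  · rw [← Set.inter_union_distrib_left, Set.inter_eq_left.2 hXAB]
  · rw [← Set.inter_union_distrib_left, Set.inter_eq_left.2 hYAB]

theorem SplitOn.polarOn_two_join {X Y : Set V} (hX : SplitOn G X) (hY : SplitOn G Y)
    (hXY : AllEdges G X Y) : PolarOn G 2 (X ∪ Y) := by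
  obtain ⟨A, B, rfl, hA, hB⟩ := hX
  obtain ⟨C, D, rfl, hC, hD⟩ := hY
  refine ⟨A ∪ C, B ∪ D, Set.union_union_union_comm .., ?_, ?_⟩
  · exact isCompleteMultipartiteLE_two_of_allEdges hA hC
      fun x hx y hy => hXY x (.inl hx) y (.inl hy)
  · exact (isClique_union_of_allEdges (fun x hx y hy => hXY x (.inr hx) y (.inr hy)) hB hD).clusterOn

/-- If `Y` is a single vertex, it serves as the second part. Otherwise deleting any vertex of `Y`
leaves, as the only case of `join_cases`, `X` a cluster and the rest of `Y` independent. -/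
theorem polarOn_two_of_not_splitOn {X Y : Set V} (hXY : AllEdges G X Y) (hX : X.Nonempty)
    (hY : Y.Nonempty) (hn : ¬ PolarOn G 1 (X ∪ Y))
    (hmin : ∀ S ⊂ X ∪ Y, PolarOn G 1 S) (hXs : ¬ SplitOn G X) : PolarOn G 2 (X ∪ Y) := by
  have hd : ∀ x ∈ X, x ∉ Y := fun x hx hy => G.irrefl (hXY x hx x hy)
  by_cases hY' : Y.Subsingleton
  · obtain ⟨w, rfl⟩ := Set.exists_eq_singleton_iff_nonempty_subsingleton.2 ⟨hY, hY'⟩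
    have hlt : X ⊂ X ∪ {w} := by
      refine ⟨Set.subset_union_left, fun h => hd w (h (.inr rfl)) rfl⟩
    obtain ⟨A, B, rfl, hA, hB⟩ := polarOn_one_iff.1 (hmin X hlt)
    refine ⟨A ∪ {w}, B, by rw [Set.union_right_comm], ?_, hB⟩
    exact isCompleteMultipartiteLE_two_of_allEdges hA (by simp [IndepOn])
      fun x hx y hy => hXY x (.inl hx) y hy
  have hdel : ∀ w ∈ Y, ClusterOn G X ∧ IndepOn G (Y \ {w}) := by
    intro w hw
    have hlt : X ∪ Y \ {w} ⊂ X ∪ Y := by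
      refine ⟨Set.union_subset_union_right _ Set.sdiff_subset, fun h => ?_⟩
      rcases h (.inr hw) with h | h
      exacts [hd w h hw, h.2 rfl]
    have hne : (Y \ {w}).Nonempty := by
      by_contra hne
      rw [Set.not_nonempty_iff_eq_empty, Set.sdiff_eq_empty] at hne
      exact hY' (Set.subsingleton_singleton.anti hne)
    rcases (hmin _ hlt).join_cases (fun x hx y hy => hXY x hx y hy.1) hX hne with h | h | h
    · exact (hXs h.1.splitOn).elim
    · exact h
    · exact (hXs h.1).elim
  obtain ⟨w, hw⟩ := hY
  have hXc := (hdel w hw).1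
  have hYi : ¬ IndepOn G Y := fun h =>
    hn (polarOn_one_iff.2 ⟨Y, X, Set.union_comm _ _, h, hXc⟩)
  simp only [IndepOn, not_forall, not_not] at hYi
  obtain ⟨u, hu, v, hv, huv⟩ := hYi
  -- Deleting a third vertex of `Y` would leave the edge `uv` in an independent set.
  have hYuv : Y = {u} ∪ {v} := by
    ext z
    constructor
    · intro hz
      by_contra h
      simp only [Set.mem_union, Set.mem_singleton_iff, not_or] at h
      exact (hdel z hz).2 u ⟨hu, fun h' => h.1 h'.symm⟩ v ⟨hv, fun h' => h.2 h'.symm⟩ huv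
    · rintro (rfl | rfl)
      exacts [hu, hv]
  refine ⟨Y, X, Set.union_comm _ _, ?_, hXc⟩
  rw [hYuv]
  exact isCompleteMultipartiteLE_two_of_allEdges (by simp [IndepOn]) (by simp [IndepOn])
    (by simpa [AllEdges] using huv)

/-- Minimality excludes a disjoint union, so the graph is a join of two smaller cographs. If both
are split, their independent sets form the two parts and their cliques join to a clique. -/
theorem IsCographMinimalObstruction.polarOn_two [Finite V]
    (h : IsCographMinimalObstruction 1 ⊤ G) : PolarOn G 2 Set.univ := by
  have := nontrivial_of_not_isPolar h.2.1
  obtain ⟨hG, hn, hmin⟩ := isCographMinimalObstruction_top_iff.1 h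
  have hmin' : ∀ S ⊂ Set.univ, PolarOn G 1 S := fun S hS => hmin S hS.ne
  have hpart : ∀ {S T : Set V}, T.Nonempty → Disjoint S T → S ≠ Set.univ := by
    rintro S T ⟨t, ht⟩ hd rfl
    exact Set.disjoint_left.1 hd (Set.mem_univ t) ht
  rcases hG.disjointSplit Set.finite_univ Set.nontrivial_univ with
    ⟨S, T, hS, hT, hd, hST, hE⟩ | ⟨S, T, hS, hT, hd, hST, hE⟩
  · exact (hn (hST ▸ (hmin S (hpart hT hd)).union_of_noEdges (hmin T (hpart hS hd.symm)) hE)).elim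
  · rw [noEdges_compl_iff hd] at hE
    rw [← hST] at hn hmin' ⊢
    by_cases hSs : SplitOn G S
    · by_cases hTs : SplitOn G T
      · exact hSs.polarOn_two_join hTs hE
      · rw [Set.union_comm] at hn hmin' ⊢
        exact polarOn_two_of_not_splitOn hE.symm hT hS hn hmin' hTs
    · exact polarOn_two_of_not_splitOn hE hS hT hn hmin' hSs

/-! ### Disconnected minimal obstructions -/

theorem noEdges_range_sum : NoEdges (G ⊕g H) (Set.range Sum.inl) (Set.range Sum.inr) := by
  rintro _ ⟨x, rfl⟩ _ ⟨y, rfl⟩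
  simp

theorem IsCograph.sum (hG : IsCograph G) (hH : IsCograph H) : IsCograph (G ⊕g H) := by
  rw [isCograph_iff] at *
  rintro (a | a) (b | b) (c | c) (d | d) <;> simp <;> solve_by_elim

theorem isCograph_pathGraph_three : IsCograph (pathGraph 3) := by
  rintro ⟨f⟩
  have := Fintype.card_le_of_embedding f.toEmbedding
  simp at this

theorem not_isPolar_pathGraph_three_sum (hH : ¬ IsPolar 1 ⊤ H) :
    ¬ IsPolar k ⊤ (pathGraph 3 ⊕g H) := by
  rw [isPolar_iff_polarOn_univ] at *
  rintro ⟨A, B, hAB, hA, hB⟩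
  have hmem : ∀ x, x ∈ A ∨ x ∈ B := fun x => by
    rw [← Set.mem_union, hAB]
    trivial
  by_cases hP : ∃ p, Sum.inl p ∈ A
  · obtain ⟨p, hp⟩ := hP
    refine hH (polarOn_one_iff.2 ⟨Sum.inr ⁻¹' A, Sum.inr ⁻¹' B, ?_, ?_, ?_⟩)
    · rw [← Set.preimage_union, hAB, Set.preimage_univ]
    · intro x hx y hy hxy
      refine hA.1.trans ⟨_, hx⟩ ⟨_, hp⟩ ⟨_, hy⟩ ?_ ?_ ?_ <;> simp [hxy]
    · intro x hx y hy z hz hxy hyz hne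
      simpa using hB _ hx _ hy _ hz (sum_adj_inr.2 hxy) (sum_adj_inr.2 hyz) (by simpa using hne)
  · push Not at hP
    have := hB (.inl 0) ((hmem _).resolve_left (hP _)) (.inl 1) ((hmem _).resolve_left (hP _))
      (.inl 2) ((hmem _).resolve_left (hP _))
    simp [pathGraph_adj] at this

theorem polarOn_one_pathGraph_three (P : Set (Fin 3)) :
    PolarOn (pathGraph 3) 1 P := by
  refine PolarOn.mono (Y := Set.univ) (polarOn_one_iff.2 ⟨{1}, {0, 2}, ?_, ?_, ?_⟩) P.subset_univ
  · ext i
    fin_cases i <;> simp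
  · simp [IndepOn]
  · refine IndepOn.clusterOn ?_
    simp [IndepOn, pathGraph_adj]

theorem clusterOn_pathGraph_three {P : Set (Fin 3)} (hP : P ≠ Set.univ) :
    ClusterOn (pathGraph 3) P := by
  intro x hx y hy z hz hxy hyz hne
  refine (hP (Set.eq_univ_of_forall fun w => ?_)).elim
  have hxy' := hxy.ne
  have hyz' := hyz.ne
  have : w = x ∨ w = y ∨ w = z := by omega
  rcases this with rfl | rfl | rfl <;> assumption

theorem ClusterOn.image {X : Set W} (h : ClusterOn H X) (f : H ↪g G) : ClusterOn G (f '' X) := by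
  rintro _ ⟨x, hx, rfl⟩ _ ⟨y, hy, rfl⟩ _ ⟨z, hz, rfl⟩ hxy hyz hne
  exact f.map_adj_iff.2 (h _ hx _ hy _ hz (f.map_adj_iff.1 hxy) (f.map_adj_iff.1 hyz)
    fun h => hne (congrArg f h))

/-- A vertex missing from `H` leaves two `(1, ∞)`-polar pieces. A vertex missing from the path
leaves a cluster beside a possibly intact `H`, which is where `polarOn_two` and `2 ≤ k` are needed.
-/
theorem IsCographMinimalObstruction.pathGraph_three_sum [Finite W] (hk : 2 ≤ k)
    (hH : IsCographMinimalObstruction 1 ⊤ H) :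
    IsCographMinimalObstruction k ⊤ (pathGraph 3 ⊕g H) := by
  refine isCographMinimalObstruction_top_iff.2 ⟨isCograph_pathGraph_three.sum hH.1, ?_, ?_⟩
  · rw [← isPolar_iff_polarOn_univ]
    exact not_isPolar_pathGraph_three_sum hH.2.1
  intro S hS
  have hS' : S = Embedding.sumInl (G := pathGraph 3) (H := H) '' (Sum.inl ⁻¹' S) ∪
      Embedding.sumInr (G := pathGraph 3) (H := H) '' (Sum.inr ⁻¹' S) := by
    ext (x | x) <;> simp
  have hE : NoEdges (pathGraph 3 ⊕g H)
      (Embedding.sumInl (G := pathGraph 3) (H := H) '' (Sum.inl ⁻¹' S))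
      (Embedding.sumInr (G := pathGraph 3) (H := H) '' (Sum.inr ⁻¹' S)) := fun x hx y hy =>
    noEdges_range_sum x (Set.image_subset_range _ _ hx) y (Set.image_subset_range _ _ hy)
  rw [hS']
  by_cases hP : Sum.inl ⁻¹' S = (Set.univ : Set (Fin 3))
  · have hQ : Sum.inr ⁻¹' S ≠ (Set.univ : Set W) := fun hQ => hS <| by
      rw [hS', hP, hQ]
      ext (x | x) <;> simp
    refine (PolarOn.union_of_noEdges ?_ ?_ hE).le (le_trans one_le_two hk)
    · rw [polarOn_image_iff]
      exact polarOn_one_pathGraph_three _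
    · rw [polarOn_image_iff]
      exact (isCographMinimalObstruction_top_iff.1 hH).2.2 _ hQ
  · rw [Set.union_comm]
    refine PolarOn.union_clusterOn ?_ ((clusterOn_pathGraph_three hP).image _) hE.symm
    rw [polarOn_image_iff]
    exact (hH.polarOn_two.le hk).mono (Set.subset_univ _)

/-- The isomorphism of complements given by an isomorphism. -/
def SimpleGraph.Iso.compl (e : G ≃g H) : Gᶜ ≃g Hᶜ where
  toEquiv := e.toEquiv
  map_rel_iff' := (Embedding.complEquiv e.toEmbedding).map_adj_iff

/-- The embedding of a disjoint sum given by embeddings without edges between their ranges. -/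
def SimpleGraph.Embedding.sumElim {U : Type*} {K : SimpleGraph U} (f : G ↪g K) (g : H ↪g K)
    (hd : ∀ x y, f x ≠ g y) (h : ∀ x y, ¬ K.Adj (f x) (g y)) : G ⊕g H ↪g K where
  toFun := Sum.elim f g
  inj' := f.injective.sumElim g.injective hd
  map_rel_iff' {x y} := by
    rcases x with x | x <;> rcases y with y | y
    · simp
    · simpa using h x y
    · simpa using fun h' => h y x (K.adj_symm h')
    · simp

theorem exists_embedding_pathGraph_three {Y : Set V} (h : ¬ ClusterOn G Y) :
    ∃ f : pathGraph 3 ↪g G, ∀ i, f i ∈ Y := by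
  simp only [ClusterOn, not_forall] at h
  obtain ⟨x, hx, y, hy, z, hz, hxy, hyz, hne, hxz⟩ := h
  have inj : Function.Injective ![x, y, z] := by
    intro i j
    fin_cases i <;> fin_cases j <;> simp [hxy.ne, hyz.ne, hne, hxy.ne', hyz.ne', hne.symm]
  have adj : ∀ i j, G.Adj (![x, y, z] i) (![x, y, z] j) ↔ (pathGraph 3).Adj i j := by
    intro i j
    rw [pathGraph_adj]
    fin_cases i <;> fin_cases j <;>
      simp [hxy, hyz, hxz, hxy.symm, hyz.symm, mt Adj.symm hxz]
  refine ⟨⟨⟨_, inj⟩, adj _ _⟩, fun i => ?_⟩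
  fin_cases i
  exacts [hx, hy, hz]

theorem exists_iso_fin [Finite V] (G : SimpleGraph V) :
    ∃ (n : ℕ) (F : SimpleGraph (Fin n)), Nonempty (F ≃g G) := by
  obtain ⟨n, ⟨e⟩⟩ := Finite.exists_equiv_fin V
  exact ⟨n, G.comap e.symm, ⟨Iso.comap e.symm G⟩⟩

theorem IsCographMinimalObstruction.exists_iso_of_noEdges [Finite V]
    (h : IsCographMinimalObstruction k ⊤ G) {X Y : Set V} (hXY : X ∪ Y = Set.univ)
    (hd : Disjoint X Y) (hY : Y.Nonempty) (hE : NoEdges G X Y) (hX : ¬ PolarOn G 1 X) :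
    ∃ (n : ℕ) (F : SimpleGraph (Fin n)), IsCographMinimalObstruction 1 ⊤ F ∧
      Nonempty (G ≃g pathGraph 3 ⊕g F) := by
  obtain ⟨hG, hn, hmin⟩ := isCographMinimalObstruction_top_iff.1 h
  by_cases hYc : ClusterOn G Y
  · refine (hn (hXY ▸ (hmin X ?_).union_clusterOn hYc hE)).elim
    rintro rfl
    exact hY.ne_empty (Set.univ_disjoint.1 hd)
  obtain ⟨p, hp⟩ := exists_embedding_pathGraph_three hYc
  obtain ⟨S, hSX, hS⟩ := exists_minimal_obstruction hG hX
  obtain ⟨n, F, ⟨e⟩⟩ := exists_iso_fin (G.induce S)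
  have hF := hS.of_iso e
  let f : F ↪g G := (Embedding.induce S).comp e.toEmbedding
  have hf : ∀ i, f i ∈ X := fun i => hSX (e i).2
  refine ⟨n, F, hF, ⟨(h.iso (p.sumElim f (fun i j hij => ?_) fun i j hij => ?_)
    (not_isPolar_pathGraph_three_sum hF.2.1)).symm⟩⟩
  · exact Set.disjoint_left.1 hd (hf j) (hij ▸ hp i)
  · exact hE _ (hf j) _ (hp i) hij.symm

theorem not_connected_and_isCographMinimalObstruction_iff [Finite V] (hk : 2 ≤ k) :
    (¬ G.Connected ∧ IsCographMinimalObstruction k ⊤ G) ↔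
      ∃ (n : ℕ) (F : SimpleGraph (Fin n)), IsCographMinimalObstruction 1 ⊤ F ∧
        Nonempty (G ≃g pathGraph 3 ⊕g F) := by
  constructor
  · rintro ⟨hc, h⟩
    have := nontrivial_of_not_isPolar h.2.1
    obtain ⟨S, T, hS, hT, hd, hST, hE⟩ := disjointSplit_of_not_connected hc
    by_cases hS1 : PolarOn G 1 S
    · by_cases hT1 : PolarOn G 1 T
      · refine (h.2.1 (isPolar_iff_polarOn_univ.2 ?_)).elim
        rw [← hST]
        exact (hS1.union_of_noEdges hT1 hE).le (le_trans one_le_two hk)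
      · exact h.exists_iso_of_noEdges (by rwa [Set.union_comm]) hd.symm hS hE.symm hT1
    · exact h.exists_iso_of_noEdges hST hd hT hE hS1
  · rintro ⟨n, F, hF, ⟨e⟩⟩
    refine ⟨?_, (hF.pathGraph_three_sum hk).of_iso e⟩
    rw [e.connected_iff]
    have := nontrivial_of_not_isPolar hF.2.1
    exact DisjointSplit.not_connected ⟨_, _, Set.range_nonempty _, Set.range_nonempty _,
      Set.isCompl_range_inl_range_inr.disjoint, Set.range_inl_union_range_inr, noEdges_range_sum⟩

/-- A cograph on at least two vertices is connected exactly when its complement is not. -/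
theorem connected_and_isCographMinimalObstruction_iff_compl [Finite V] :
    (G.Connected ∧ IsCographMinimalObstruction ⊤ k G) ↔
      (¬ Gᶜ.Connected ∧ IsCographMinimalObstruction k ⊤ Gᶜ) := by
  rw [isCographMinimalObstruction_compl]
  refine and_congr_left fun h => ?_
  have := nontrivial_of_not_isPolar (isPolar_compl.not.2 h.2.1)
  constructor
  · intro hc
    rcases h.1.disjointSplit Set.finite_univ Set.nontrivial_univ with h' | h'
    · exact (h'.not_connected hc).elim
    · exact h'.not_connected
  · exact fun hc => G.connected_or_connected_compl.resolve_right hc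

theorem connected_and_isCographMinimalObstruction_iff [Finite V] (hk : 2 ≤ k) :
    (G.Connected ∧ IsCographMinimalObstruction ⊤ k G) ↔
      ∃ (n : ℕ) (F : SimpleGraph (Fin n)), IsCographMinimalObstruction 1 ⊤ F ∧
        Nonempty (G ≃g (pathGraph 3 ⊕g F)ᶜ) := by
  rw [connected_and_isCographMinimalObstruction_iff_compl,
    not_connected_and_isCographMinimalObstruction_iff hk]
  refine exists_congr fun n => exists_congr fun F => and_congr_right fun _ => ?_
  constructor
  · rintro ⟨e⟩
    exact ⟨by simpa using e.compl⟩
  · rintro ⟨e⟩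
    exact ⟨by simpa using e.compl⟩

/-! ### Cographs are well-quasi-ordered -/

/-- The induced subgraph order on finite graphs. -/
def IndLE (F F' : Σ n : ℕ, SimpleGraph (Fin n)) : Prop := F.2.IsIndContained F'.2

instance : IsPreorder (Σ n : ℕ, SimpleGraph (Fin n)) IndLE where
  refl _ := IsIndContained.rfl
  trans _ _ _ h h' := h.trans h'

/-- The disjoint union or the join of two graphs. -/
def cographOp (b : Bool) (G : SimpleGraph V) (H : SimpleGraph W) : SimpleGraph (V ⊕ W) :=
  if b then G ⊕g H else (Gᶜ ⊕g Hᶜ)ᶜ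

theorem isIndContained_sum {V' W' : Type*} {G' : SimpleGraph V'} {H' : SimpleGraph W'}
    (hG : G.IsIndContained G') (hH : H.IsIndContained H') :
    (G ⊕g H).IsIndContained (G' ⊕g H') :=
  hG.elim fun f => hH.elim fun g => ⟨f.sum g⟩

theorem isIndContained_cographOp {V' W' : Type*} {G' : SimpleGraph V'} {H' : SimpleGraph W'}
    (b : Bool) (hG : G.IsIndContained G') (hH : H.IsIndContained H') :
    (cographOp b G H).IsIndContained (cographOp b G' H') := by
  cases b
  · exact (isIndContained_sum hG.compl hH.compl).compl
  · exact isIndContained_sum hG hH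

theorem isIndContained_cographOp_left (b : Bool) : G.IsIndContained (cographOp b G H) := by
  cases b
  · exact IsIndContained.of_compl (by simpa [cographOp] using ⟨Embedding.sumInl⟩)
  · exact ⟨Embedding.sumInl⟩

theorem isIndContained_cographOp_right (b : Bool) : H.IsIndContained (cographOp b G H) := by
  cases b
  · exact IsIndContained.of_compl (by simpa [cographOp] using ⟨Embedding.sumInr⟩)
  · exact ⟨Embedding.sumInr⟩

theorem DisjointSplit.exists_iso_sum [Finite V] (h : DisjointSplit G Set.univ) :
    ∃ F₁ F₂ : Σ n : ℕ, SimpleGraph (Fin n), 0 < F₁.1 ∧ 0 < F₂.1 ∧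
      Nonempty (F₁.2 ⊕g F₂.2 ≃g G) := by
  obtain ⟨S, T, hS, hT, hd, hST, hE⟩ := h
  have := hS.to_subtype
  have := hT.to_subtype
  obtain ⟨m, F, ⟨e⟩⟩ := exists_iso_fin (G.induce S)
  obtain ⟨n, F', ⟨e'⟩⟩ := exists_iso_fin (G.induce T)
  refine ⟨⟨m, F⟩, ⟨n, F'⟩, ?_, ?_, ⟨RelIso.ofSurjective
    (((Embedding.induce S).comp e.toEmbedding).sumElim ((Embedding.induce T).comp e'.toEmbedding)
      (fun x y => hd.ne_of_mem (e x).2 (e' y).2) fun x y => hE _ (e x).2 _ (e' y).2) ?_⟩⟩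
  · exact Fin.pos_iff_nonempty.2 (e.symm.toEquiv.nonempty_congr.1 inferInstance)
  · exact Fin.pos_iff_nonempty.2 (e'.symm.toEquiv.nonempty_congr.1 inferInstance)
  · intro v
    have hv : v ∈ S ∪ T := hST ▸ Set.mem_univ v
    rcases hv with hv | hv
    · exact ⟨.inl (e.symm ⟨v, hv⟩), congrArg Subtype.val (e.apply_symm_apply ⟨v, hv⟩)⟩
    · exact ⟨.inr (e'.symm ⟨v, hv⟩), congrArg Subtype.val (e'.apply_symm_apply ⟨v, hv⟩)⟩

theorem IsCograph.exists_cographOp_iso [Finite V] [Nontrivial V] (hG : IsCograph G) :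
    ∃ (b : Bool) (F₁ F₂ : Σ n : ℕ, SimpleGraph (Fin n)), 0 < F₁.1 ∧ 0 < F₂.1 ∧
      Nonempty (cographOp b F₁.2 F₂.2 ≃g G) := by
  rcases hG.disjointSplit Set.finite_univ Set.nontrivial_univ with h | h
  · obtain ⟨F₁, F₂, h₁, h₂, e⟩ := h.exists_iso_sum
    exact ⟨true, F₁, F₂, h₁, h₂, e⟩
  · obtain ⟨F₁, F₂, h₁, h₂, ⟨e⟩⟩ := h.exists_iso_sum
    refine ⟨false, ⟨_, F₁.2ᶜ⟩, ⟨_, F₂.2ᶜ⟩, h₁, h₂, ⟨?_⟩⟩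
    simpa [cographOp] using e.compl

-- Nash-Williams' argument: a bad sequence `g` of smaller elements below terms of `f` could be
-- spliced onto an initial segment of `f`, contradicting minimality.
open Set.PartiallyWellOrderedOn in
theorem partiallyWellOrderedOn_of_isMinBadSeq {α : Type*} {r : α → α → Prop} [IsPreorder α r]
    {rk : α → ℕ} {s : Set α} {f : ℕ → α} (hf : IsBadSeq r s f)
    (hmin : ∀ n, IsMinBadSeq r rk s n f) :
    {x ∈ s | ∃ n, r x (f n) ∧ rk x < rk (f n)}.PartiallyWellOrderedOn r := by
  rw [iff_forall_not_isBadSeq]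
  rintro g ⟨hg, hbad⟩
  choose hgs φ hφ hrk using hg
  -- With `φ i` least, a relation from a kept `f m` to a later `g j` would relate `f m` to `f (φ j)`
  -- with `m < φ j`.
  obtain ⟨i, hi⟩ : ∃ i, ∀ j, φ i ≤ φ j :=
    ⟨Function.argmin φ, fun j => Function.argmin_le φ j⟩
  refine hmin (φ i) (fun m => if m < φ i then f m else g (i + (m - φ i)))
    (fun m hm => (if_pos hm).symm) (by simpa using hrk i) ⟨fun m => ?_, fun m n hmn => ?_⟩
  · dsimp only
    split_ifs
    exacts [hf.1 m, hgs _]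
  · dsimp only
    split_ifs with hm hn hn
    · exact hf.2 m n hmn
    · exact fun h => hf.2 m _ (hm.trans_le (hi _)) (_root_.trans h (hφ _))
    · exact (hm (hmn.trans hn)).elim
    · exact hbad _ _ (by omega)

theorem isIndContained_of_subsingleton [Subsingleton V] [Nonempty W] :
    G.IsIndContained H := by
  obtain ⟨w⟩ := ‹Nonempty W›
  refine ⟨⟨⟨fun _ => w, fun x y _ => Subsingleton.elim x y⟩, fun {x y} => ?_⟩⟩
  simp [Subsingleton.elim x y]

/-- The factors of the terms of a minimal bad sequence are smaller, hence well-quasi-ordered. Making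
both factors monotone along a subsequence and repeating the operation `b` makes two terms
comparable. -/
theorem partiallyWellOrderedOn_isCograph :
    {F : Σ n : ℕ, SimpleGraph (Fin n) | IsCograph F.2}.PartiallyWellOrderedOn IndLE := by
  rw [Set.PartiallyWellOrderedOn.iff_not_exists_isMinBadSeq Sigma.fst]
  rintro ⟨f, hf, hmin⟩
  have hT := partiallyWellOrderedOn_of_isMinBadSeq hf hmin
  have hnt : ∀ n, Nontrivial (Fin (f n).1) := fun n => by
    by_contra h
    rw [not_nontrivial_iff_subsingleton] at h
    -- A graph on at most one vertex embeds in every nonempty graph; if the next term is empty, it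
    -- embeds in its successor.
    rcases isEmpty_or_nonempty (Fin (f (n + 1)).1) with h' | h'
    · exact hf.2 (n + 1) (n + 2) (by omega) IsIndContained.of_isEmpty
    · exact hf.2 n (n + 1) (by omega) isIndContained_of_subsingleton
  choose b F₁ F₂ h₁ h₂ e using fun n => (hf.1 n).exists_cographOp_iso
  have hcard : ∀ n, (F₁ n).1 + (F₂ n).1 = (f n).1 := fun n => by
    obtain ⟨e⟩ := e n
    simpa using Fintype.card_congr e.toEquiv
  have hle₁ : ∀ n, IndLE (F₁ n) (f n) := fun n =>
    (isIndContained_cographOp_left (b n)).trans ⟨(e n).some.toEmbedding⟩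
  have hle₂ : ∀ n, IndLE (F₂ n) (f n) := fun n =>
    (isIndContained_cographOp_right (b n)).trans ⟨(e n).some.toEmbedding⟩
  obtain ⟨g, hg⟩ := hT.exists_monotone_subseq (f := F₁) fun n =>
    ⟨(hf.1 n).of_embedding (hle₁ n).some, n, hle₁ n, by have := hcard n; have := h₂ n; omega⟩
  obtain ⟨g', hg'⟩ := hT.exists_monotone_subseq (f := F₂ ∘ g) fun n =>
    ⟨(hf.1 (g n)).of_embedding (hle₂ (g n)).some, g n, hle₂ (g n), by
      have := hcard (g n); have := h₁ (g n); dsimp; omega⟩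
  obtain ⟨m, n, hmn, hb⟩ := Finite.wellQuasiOrdered (· = ·) (fun n => b (g (g' n)))
  refine hf.2 _ _ (g.strictMono (g'.strictMono hmn)) ?_
  have key := isIndContained_cographOp (b (g (g' m))) (hg _ _ (g'.monotone hmn.le))
    (hg' _ _ hmn.le)
  have h1 : (f (g (g' m))).2.IsIndContained (cographOp (b (g (g' m))) _ _) :=
    ⟨(e (g (g' m))).some.symm.toEmbedding⟩
  refine h1.trans (key.trans ?_)
  rw [hb]
  exact ⟨(e (g (g' n))).some.toEmbedding⟩

/-- Comparable minimal obstructions are isomorphic, so well-quasi-ordering bounds the set of orders;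
each order carries finitely many graphs. -/
theorem finite_isCographMinimalObstruction (s k : ℕ∞) :
    {F : Σ n : ℕ, SimpleGraph (Fin n) | IsCographMinimalObstruction s k F.2}.Finite := by
  set M := {F : Σ n : ℕ, SimpleGraph (Fin n) | IsCographMinimalObstruction s k F.2}
  have hsize : (Sigma.fst '' M).Finite := by
    by_contra hinf
    let n := Set.Infinite.natEmbedding _ hinf
    choose F hF hFn using fun i => (n i).2
    obtain ⟨i, j, hij, ⟨f⟩⟩ := partiallyWellOrderedOn_isCograph.exists_lt (f := F)
      fun i => (hF i).1
    have e := (hF j).iso f (hF i).2.1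
    have := Fintype.card_congr e.toEquiv
    rw [Fintype.card_fin, Fintype.card_fin, hFn, hFn] at this
    exact hij.ne (n.injective (Subtype.ext this))
  refine (hsize.biUnion fun n _ => Set.finite_range (Sigma.mk n)).subset fun F hF => ?_
  exact Set.mem_biUnion (Set.mem_image_of_mem _ hF) ⟨F.2, rfl⟩

/-! ### Assembly of the four claims -/

theorem mainTheorem3 :
    (∀ (k : ℕ), 2 ≤ k → ∀ (V : Type u) [Finite V] (G : SimpleGraph V),
      (¬ G.Connected →
        (IsCographMinimalObstruction (k : ℕ∞) ⊤ G ↔ IsCographMinimalPolarObstruction G)) ∧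
      ((G.Connected ∧ IsCographMinimalObstruction ⊤ (k : ℕ∞) G) ↔
        (G.Connected ∧ IsCographMinimalPolarObstruction G)) ∧
      ((G.Connected ∧ IsCographMinimalObstruction ⊤ (k : ℕ∞) G) ↔
        ∃ (n : ℕ) (H : SimpleGraph (Fin n)), IsCographMinimalObstruction 1 ⊤ H ∧
          Nonempty (G ≃g (SimpleGraph.sum (SimpleGraph.pathGraph 3) H)ᶜ))) ∧
    -- up to isomorphism there are finitely many of them, the same ones for every `k ≥ 2`
    (∃ L : Finset (Σ n : ℕ, SimpleGraph (Fin n)),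
      ∀ (k : ℕ), 2 ≤ k → ∀ (V : Type u) [Finite V] (G : SimpleGraph V),
        (G.Connected ∧ IsCographMinimalObstruction ⊤ (k : ℕ∞) G) ↔
          ∃ F ∈ L, Nonempty (G ≃g F.2)) := by
  have hk : ∀ {k : ℕ}, 2 ≤ k → (2 : ℕ∞) ≤ k := fun h => by exact_mod_cast h
  refine ⟨fun k hk2 V _ G => ⟨fun hG => ?_, ?_,
    connected_and_isCographMinimalObstruction_iff (hk hk2)⟩, ?_⟩
  · have h := not_connected_and_isCographMinimalObstruction_iff (G := G) (hk hk2)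
    -- The same characterization at `k = ⊤` describes the polar obstructions.
    have h' := not_connected_and_isCographMinimalObstruction_iff (G := G) (k := ⊤) le_top
    simpa [hG, IsCographMinimalPolarObstruction] using h.trans h'.symm
  · exact (connected_and_isCographMinimalObstruction_iff (hk hk2)).trans
      (connected_and_isCographMinimalObstruction_iff le_top).symm
  · choose rep hrep using fun F : Σ n : ℕ, SimpleGraph (Fin n) =>
      (exists_iso_fin (pathGraph 3 ⊕g F.2)ᶜ : ∃ (n : ℕ) (K : SimpleGraph (Fin n)), _)
    choose K hK using hrep
    have hfin := (finite_isCographMinimalObstruction 1 ⊤).image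
      fun F => (⟨rep F, K F⟩ : Σ n : ℕ, SimpleGraph (Fin n))
    refine ⟨hfin.toFinset, fun k hk2 V _ G => ?_⟩
    rw [connected_and_isCographMinimalObstruction_iff (hk hk2)]
    simp only [Set.Finite.mem_toFinset, Set.exists_mem_image]
    constructor
    · rintro ⟨n, H, hH, ⟨e⟩⟩
      exact ⟨⟨n, H⟩, hH, ⟨e.trans (hK ⟨n, H⟩).some.symm⟩⟩
    · rintro ⟨F, hF, ⟨e⟩⟩
      exact ⟨F.1, F.2, hF, ⟨e.trans (hK F).some⟩⟩
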